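/- Let $n\ge 0$ and $k\geq 1$ be integers and let $A$ be an $n\times n$ matrix with nonnegative real entries. Consider two algebras on $\mathbb{R}_+=[0,\infty)$, both with the usual multiplication: nonnegative algebra, with the usual addition, and max algebra, with addition $a\oplus b:=\max(a,b)$. In each of them, matrix products, matrix-vector products and the power $A^k$ are formed with the addition of that algebra (in max algebra, $(A\otimes B)_{ij}=\max_l a_{il}b_{lj}$ and $(A\otimes x)_i=\max_j a_{ij}x_j$). An eigenvalue of a nonnegative matrix $B$ is a number $\rho\in\mathbb{R}_+$ for which there is a nonzero vector $x\in\mathbb{R}_+^n$ such that the product of $B$ and $x$ in that algebra equals $\rho x$; let $\Lambda(B)$ denote the set of nonzero eigenvalues of $B$. Then, both in nonnegative algebra and in max algebra, $$\Lambda(A^k)=\{\rho^k\colon \rho\in\Lambda(A)\}.$$ -/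

import Mathlib

open scoped NNReal

/-- The matrix product of max algebra: `(A ⊗ B) i j = max_l A i l * B l j`
(the supremum over the empty index set is `0`, the least element of `ℝ≥0`). -/
noncomputable def maxMul {n : ℕ} (A B : Matrix (Fin n) (Fin n) ℝ≥0) :
    Matrix (Fin n) (Fin n) ℝ≥0 :=
  Matrix.of fun i j => Finset.univ.sup fun l => A i l * B l j

/-- The matrix-vector product of max algebra: `(A ⊗ x) i = max_j A i j * x j`. -/
noncomputable def maxMulVec {n : ℕ} (A : Matrix (Fin n) (Fin n) ℝ≥0) (x : Fin n → ℝ≥0) :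
    Fin n → ℝ≥0 :=
  fun i => Finset.univ.sup fun j => A i j * x j

/-- The powers `A^{⊗ k}` of max algebra. The matrix `1`, with ones on the diagonal and zeros
elsewhere, is the unit of `maxMul` too, so `maxPow A 1 = A`. -/
noncomputable def maxPow {n : ℕ} (A : Matrix (Fin n) (Fin n) ℝ≥0) :
    ℕ → Matrix (Fin n) (Fin n) ℝ≥0
  | 0 => 1
  | k + 1 => maxMul (maxPow A k) A

/-- The set of nonzero eigenvalues of a nonnegative matrix in nonnegative algebra: those `ρ ≠ 0`
that have a nonzero nonnegative eigenvector. -/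
def spectrumNonneg {n : ℕ} (A : Matrix (Fin n) (Fin n) ℝ≥0) : Set ℝ≥0 :=
  {ρ | ρ ≠ 0 ∧ ∃ x : Fin n → ℝ≥0, x ≠ 0 ∧ A.mulVec x = ρ • x}

/-- The set of nonzero eigenvalues of a nonnegative matrix in max algebra. -/
def spectrumMax {n : ℕ} (A : Matrix (Fin n) (Fin n) ℝ≥0) : Set ℝ≥0 :=
  {ρ | ρ ≠ 0 ∧ ∃ x : Fin n → ℝ≥0, x ≠ 0 ∧ maxMulVec A x = ρ • x}

/-! Iterating `A` on an eigenvector gives one inclusion. For the other, write the eigenvalue of the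
power as `ρ ^ k`. Then `B = ρ⁻¹ A` satisfies `Bᵏ x = x`, so `B` shifts `x, B x, …, Bᵏ⁻¹ x`
cyclically and fixes their sum (in max algebra, their maximum). This vector is nonzero because it
dominates `x`. Only linearity over the respective addition is used, so one argument serves both
algebras. -/

theorem exists_pow_eq_nnreal {k : ℕ} (hk : k ≠ 0) {μ : ℝ≥0} (hμ : μ ≠ 0) :
    ∃ ρ : ℝ≥0, ρ ≠ 0 ∧ ρ ^ k = μ := by
  have h : (μ ^ (k : ℝ)⁻¹) ^ k = μ := NNReal.rpow_inv_natCast_pow μ hk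
  refine ⟨μ ^ (k : ℝ)⁻¹, fun h0 => hμ ?_, h⟩
  rw [← h, h0, zero_pow hk]

section Nonneg

variable {n : ℕ}

theorem pow_mulVec_eq_pow_smul {A : Matrix (Fin n) (Fin n) ℝ≥0} {x : Fin n → ℝ≥0} {ρ : ℝ≥0}
    (h : A.mulVec x = ρ • x) (k : ℕ) : (A ^ k).mulVec x = ρ ^ k • x := by
  induction k with
  | zero => simp
  | succ k ih => rw [pow_succ, ← Matrix.mulVec_mulVec, h, Matrix.mulVec_smul, ih,
      smul_smul, pow_succ']

/-- An eigenvector of `A ^ k` for `ρ ^ k` yields the eigenvector `∑ j < k, ρ⁻ʲ Aʲ x` of `A`. -/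
theorem exists_mulVec_eq_smul_of_pow {A : Matrix (Fin n) (Fin n) ℝ≥0} {x : Fin n → ℝ≥0} {ρ : ℝ≥0}
    (hρ : ρ ≠ 0) (hx : x ≠ 0) {k : ℕ} (hk : 1 ≤ k) (h : (A ^ k).mulVec x = ρ ^ k • x) :
    ∃ y : Fin n → ℝ≥0, y ≠ 0 ∧ A.mulVec y = ρ • y := by
  let g : ℕ → Fin n → ℝ≥0 := fun j => (ρ⁻¹) ^ j • (A ^ j).mulVec x
  have g0 : g 0 = x := by simp [g]
  have gk : g k = x := by
    simp only [g, h, smul_smul, ← mul_pow, inv_mul_cancel₀ hρ, one_pow, one_smul]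
  have hg : ∀ j, A.mulVec (g j) = ρ • g (j + 1) := by
    intro j
    simp only [g, Matrix.mulVec_smul, Matrix.mulVec_mulVec, smul_smul, pow_succ' A]
    rw [pow_succ', mul_inv_cancel_left₀ hρ]
  -- Split the sum over `0, …, k` at either end and cancel `g 0 = g k`.
  have hshift : ∑ j ∈ Finset.range k, g (j + 1) = ∑ j ∈ Finset.range k, g j := by
    have := (Finset.sum_range_succ' g k).symm.trans (Finset.sum_range_succ g k)
    rw [g0, gk] at this
    exact add_right_cancel this
  refine ⟨∑ j ∈ Finset.range k, g j, fun hy => hx ?_, ?_⟩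
  · rw [← g0]
    exact Finset.sum_eq_zero_iff.1 hy 0 (Finset.mem_range.2 hk)
  · rw [Matrix.mulVec_sum, Finset.sum_congr rfl fun j _ => hg j, ← Finset.smul_sum, hshift]

theorem spectrumNonneg_pow (A : Matrix (Fin n) (Fin n) ℝ≥0) {k : ℕ} (hk : 1 ≤ k) :
    spectrumNonneg (A ^ k) = (fun ρ : ℝ≥0 => ρ ^ k) '' spectrumNonneg A := by
  ext μ
  constructor
  · rintro ⟨hμ, x, hx, h⟩
    obtain ⟨ρ, hρ, rfl⟩ := exists_pow_eq_nnreal (by omega : k ≠ 0) hμ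
    exact ⟨ρ, ⟨hρ, exists_mulVec_eq_smul_of_pow hρ hx hk h⟩, rfl⟩
  · rintro ⟨ρ, ⟨hρ, x, hx, h⟩, rfl⟩
    exact ⟨pow_ne_zero k hρ, x, hx, pow_mulVec_eq_pow_smul h k⟩

end Nonneg

section Max

variable {n : ℕ}

theorem maxMulVec_smul (A : Matrix (Fin n) (Fin n) ℝ≥0) (c : ℝ≥0) (x : Fin n → ℝ≥0) :
    maxMulVec A (c • x) = c • maxMulVec A x := by
  ext1 i
  simp only [maxMulVec, Pi.smul_apply, smul_eq_mul, NNReal.mul_finset_sup, mul_left_comm]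

theorem maxMulVec_sup (A : Matrix (Fin n) (Fin n) ℝ≥0) {ι : Type*} (s : Finset ι)
    (g : ι → Fin n → ℝ≥0) : maxMulVec A (s.sup g) = s.sup fun j => maxMulVec A (g j) := by
  ext1 i
  simp only [maxMulVec, Finset.sup_apply, NNReal.mul_finset_sup]
  exact Finset.sup_comm _ _ _

theorem maxMulVec_maxMulVec (A B : Matrix (Fin n) (Fin n) ℝ≥0) (x : Fin n → ℝ≥0) :
    maxMulVec A (maxMulVec B x) = maxMulVec (maxMul A B) x := by
  ext1 i
  simp only [maxMulVec, maxMul, Matrix.of_apply, NNReal.mul_finset_sup, NNReal.finset_sup_mul,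
    mul_assoc]
  exact Finset.sup_comm _ _ _

theorem maxMulVec_one (x : Fin n → ℝ≥0) : maxMulVec 1 x = x := by
  ext1 i
  refine le_antisymm (Finset.sup_le fun j _ => ?_) ?_
  · by_cases hij : i = j
    · subst hij
      rw [Matrix.one_apply_eq, one_mul]
    · rw [Matrix.one_apply_ne hij, zero_mul]
      exact zero_le
  · have h := Finset.le_sup (f := fun j => (1 : Matrix (Fin n) (Fin n) ℝ≥0) i j * x j)
      (Finset.mem_univ i)
    rw [Matrix.one_apply_eq, one_mul] at h
    exact h

/-- Passing to iterates of a map makes associativity of `maxMul` unnecessary. -/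
theorem maxMulVec_maxPow (A : Matrix (Fin n) (Fin n) ℝ≥0) (k : ℕ) (x : Fin n → ℝ≥0) :
    maxMulVec (maxPow A k) x = (maxMulVec A)^[k] x := by
  induction k generalizing x with
  | zero => exact maxMulVec_one x
  | succ k ih => rw [maxPow, ← maxMulVec_maxMulVec, ih, Function.iterate_succ_apply]

theorem maxMulVec_maxPow_eq_pow_smul {A : Matrix (Fin n) (Fin n) ℝ≥0} {x : Fin n → ℝ≥0} {ρ : ℝ≥0}
    (h : maxMulVec A x = ρ • x) (k : ℕ) : maxMulVec (maxPow A k) x = ρ ^ k • x := by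
  rw [maxMulVec_maxPow]
  induction k with
  | zero => simp
  | succ k ih => rw [Function.iterate_succ_apply', ih, maxMulVec_smul, h, smul_smul, pow_succ]

/-- Replaces the cancellation used for sums, which fails for `⊔`: the two families differ only in
the terms `g k` and `g 0`, which agree. -/
theorem sup_range_shift {α : Type*} [SemilatticeSup α] [OrderBot α] {g : ℕ → α} {k : ℕ}
    (hk : 1 ≤ k) (h : g k = g 0) :
    ((Finset.range k).sup fun j => g (j + 1)) = (Finset.range k).sup g := by
  refine le_antisymm (Finset.sup_le fun j hj => ?_) (Finset.sup_le fun j hj => ?_)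
  · rcases (Nat.succ_le_of_lt (Finset.mem_range.1 hj)).eq_or_lt with hjk | hjk
    · rw [show j + 1 = k from hjk, h]
      exact Finset.le_sup (Finset.mem_range.2 hk)
    · exact Finset.le_sup (Finset.mem_range.2 hjk)
  · rw [Finset.mem_range] at hj
    rcases j with _ | j
    · obtain ⟨m, rfl⟩ := Nat.exists_eq_add_of_le' hk
      rw [← h]
      exact Finset.le_sup (f := fun j => g (j + 1)) (Finset.self_mem_range_succ m)
    · exact Finset.le_sup (f := fun j => g (j + 1)) (Finset.mem_range.2 (by omega))

/-- An eigenvector of `maxPow A k` for `ρ ^ k` yields the eigenvector `max_{j < k} ρ⁻ʲ Aʲ x`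
of `A` in max algebra. -/
theorem exists_maxMulVec_eq_smul_of_maxPow {A : Matrix (Fin n) (Fin n) ℝ≥0} {x : Fin n → ℝ≥0}
    {ρ : ℝ≥0} (hρ : ρ ≠ 0) (hx : x ≠ 0) {k : ℕ} (hk : 1 ≤ k)
    (h : maxMulVec (maxPow A k) x = ρ ^ k • x) :
    ∃ y : Fin n → ℝ≥0, y ≠ 0 ∧ maxMulVec A y = ρ • y := by
  let g : ℕ → Fin n → ℝ≥0 := fun j => (ρ⁻¹) ^ j • (maxMulVec A)^[j] x
  have g0 : g 0 = x := by simp [g]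
  have gk : g k = x := by
    simp only [g, ← maxMulVec_maxPow, h, smul_smul, ← mul_pow, inv_mul_cancel₀ hρ, one_pow,
      one_smul]
  have hg : ∀ j, maxMulVec A (g j) = ρ • g (j + 1) := by
    intro j
    simp only [g, maxMulVec_smul, smul_smul, Function.iterate_succ_apply']
    rw [pow_succ', mul_inv_cancel_left₀ hρ]
  refine ⟨(Finset.range k).sup g, fun hy => hx ?_, ?_⟩
  · rw [← g0]
    -- The maximum dominates its term `g 0`, and `⊥` is the zero vector.
    exact le_bot_iff.1 ((Finset.le_sup (Finset.mem_range.2 hk)).trans_eq hy)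
  · rw [maxMulVec_sup, ← sup_range_shift hk (gk.trans g0.symm)]
    ext1 i
    simp only [hg, Finset.sup_apply, Pi.smul_apply, smul_eq_mul, NNReal.mul_finset_sup]

theorem spectrumMax_maxPow (A : Matrix (Fin n) (Fin n) ℝ≥0) {k : ℕ} (hk : 1 ≤ k) :
    spectrumMax (maxPow A k) = (fun ρ : ℝ≥0 => ρ ^ k) '' spectrumMax A := by
  ext μ
  constructor
  · rintro ⟨hμ, x, hx, h⟩
    obtain ⟨ρ, hρ, rfl⟩ := exists_pow_eq_nnreal (by omega : k ≠ 0) hμ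
    exact ⟨ρ, ⟨hρ, exists_maxMulVec_eq_smul_of_maxPow hρ hx hk h⟩, rfl⟩
  · rintro ⟨ρ, ⟨hρ, x, hx, h⟩, rfl⟩
    exact ⟨pow_ne_zero k hρ, x, hx, maxMulVec_maxPow_eq_pow_smul h k⟩

end Max

theorem corollary4p5 (n : ℕ) (A : Matrix (Fin n) (Fin n) ℝ≥0) (k : ℕ) (hk : 1 ≤ k) :
    spectrumNonneg (A ^ k) = (fun ρ : ℝ≥0 => ρ ^ k) '' spectrumNonneg A ∧
      spectrumMax (maxPow A k) = (fun ρ : ℝ≥0 => ρ ^ k) '' spectrumMax A :=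
  ⟨spectrumNonneg_pow A hk, spectrumMax_maxPow A hk⟩
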